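/- All Hilbert spaces are complex and all operators are bounded and linear. An operator is quasi-affine if it is injective with dense range. Operators $T\in\mathcal B(\mathcal H)$ and $\tilde T\in\mathcal B(\tilde{\mathcal H})$ are quasi-similar, $T\sim_{q.s}\tilde T$, if there are quasi-affine operators $X:\mathcal H\to\tilde{\mathcal H}$ and $Y:\tilde{\mathcal H}\to\mathcal H$ with $XT=\tilde TX$ and $TY=Y\tilde T$; they are similar, $T\sim_s\tilde T$, if $XT=\tilde TX$ for some boundedly invertible $X:\mathcal H\to\tilde{\mathcal H}$. A backward weighted shift with weights $\{w_k\}_{k\ge0}\subset\mathbb C$ on an orthonormal basis $\{e_k\}_{k\ge0}$ is an operator $S$ with $Se_0=0$ and $Se_{k+1}=w_ke_k$ for $k\ge0$. An operator $S$ is quasi-nilpotent if $\lim_{m\to\infty}\|S^m\|^{1/m}=0$. Let $\mathcal A$ be the class of all backward weighted shifts with nonzero weights that are not quasi-nilpotent (every nonzero operator intertwining two members of $\mathcal A$ has dense range). For $n\ge2$, $T=(T_{i,j})_{i,j=1}^n\in\mathcal{OF}_n(\mathcal A)$ means that $T\in\mathcal B(\mathcal H)$ has, with respect to a topological direct decomposition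 $\mathcal H=\mathcal H_1\oplus\cdots\oplus\mathcal H_n$ (not necessarily orthogonal), an operator matrix with $T_{i,j}=0$ unless $j\in\{i,i+1\}$, $T_{i,i}\in\mathcal A$ for $1\le i\le n$, and $T_{i,i+1}\neq0$, $T_{i,i}T_{i,i+1}=T_{i,i+1}T_{i+1,i+1}$ for $1\le i\le n-1$. **Proposition.** Let $n\ge2$ and let $T=(T_{i,j})_{i,j=1}^n$ and $\tilde T=(\tilde T_{i,j})_{i,j=1}^n$ be in $\mathcal{OF}_n(\mathcal A)$, with respect to decompositions $\mathcal H=\mathcal H_1\oplus\cdots\oplus\mathcal H_n$ and $\tilde{\mathcal H}=\tilde{\mathcal H}_1\oplus\cdots\oplus\tilde{\mathcal H}_n$. Suppose that 1. for $1\le i\le n$, $T_{i,i}$ (resp. $\tilde T_{i,i}$) is the backward weighted shift with nonzero weights $\{w^{(i)}_k\}_{k\ge0}$ (resp. $\{\tilde w^{(i)}_k\}_{k\ge0}$) on an orthonormal basis $\{e^{(i)}_k\}_{k\ge0}$ of $\mathcal H_i$ (resp. $\{\tilde e^{(i)}_k\}_{k\ge0}$ of $\tilde{\mathcal H}_i$);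 2. for $1\le i\le n-1$ and $k\ge0$, $$T_{i,i+1}e^{(i+1)}_k=\frac{\prod_{m=0}^{k-1}w^{(i+1)}_m}{\prod_{m=0}^{k-1}w^{(i)}_m}\,e^{(i)}_k,\qquad \tilde T_{i,i+1}\tilde e^{(i+1)}_k=\frac{\prod_{m=0}^{k-1}\tilde w^{(i+1)}_m}{\prod_{m=0}^{k-1}\tilde w^{(i)}_m}\,\tilde e^{(i)}_k,$$ where empty products are $1$. Then $T\sim_{q.s}\tilde T$ if and only if $T\sim_s\tilde T$. -/

import Mathlib

open Filter Topology

/-- A bounded operator is quasi-affine if it is injective with dense range. -/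
def IsQuasiAffine {H K : Type*} [NormedAddCommGroup H] [InnerProductSpace ℂ H]
    [NormedAddCommGroup K] [InnerProductSpace ℂ K] (X : H →L[ℂ] K) : Prop :=
  Function.Injective X ∧ DenseRange X

/-- Quasi-similarity `T ∼_{q.s} S`. -/
def AreQuasiSimilar {H K : Type*} [NormedAddCommGroup H] [InnerProductSpace ℂ H]
    [NormedAddCommGroup K] [InnerProductSpace ℂ K]
    (T : H →L[ℂ] H) (S : K →L[ℂ] K) : Prop :=
  ∃ (X : H →L[ℂ] K) (Y : K →L[ℂ] H), IsQuasiAffine X ∧ IsQuasiAffine Y ∧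
    X ∘L T = S ∘L X ∧ T ∘L Y = Y ∘L S

/-- Similarity `T ∼_s S`, through a boundedly invertible operator. -/
def AreSimilar {H K : Type*} [NormedAddCommGroup H] [InnerProductSpace ℂ H]
    [NormedAddCommGroup K] [InnerProductSpace ℂ K]
    (T : H →L[ℂ] H) (S : K →L[ℂ] K) : Prop :=
  ∃ X : H ≃L[ℂ] K, (X : H →L[ℂ] K) ∘L T = S ∘L (X : H →L[ℂ] K)

/-- `P` is quasi-nilpotent if `‖P ^ m‖ ^ (1 / m) → 0`. -/
def IsQuasiNilpotent {H : Type*} [NormedAddCommGroup H] [InnerProductSpace ℂ H]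
    (P : H →L[ℂ] H) : Prop :=
  Tendsto (fun m : ℕ => ‖P ^ m‖ ^ (1 / (m : ℝ))) atTop (𝓝 0)

/-- `T` is the backward weighted shift with weights `w` on the orthonormal basis `e`. -/
def IsBackwardWeightedShift {H : Type*} [NormedAddCommGroup H] [InnerProductSpace ℂ H]
    (e : HilbertBasis ℕ ℂ H) (w : ℕ → ℂ) (T : H →L[ℂ] H) : Prop :=
  T (e 0) = 0 ∧ ∀ k, T (e (k + 1)) = w k • e k

/-- A class `𝒜` of bounded Hilbert space operators such that every nonzero intertwiner `X` of two
members (`T X = X S`) has dense range. -/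
structure OperatorClass.{u} where
  mem : ∀ {H : Type u} [NormedAddCommGroup H] [InnerProductSpace ℂ H] [CompleteSpace H],
    (H →L[ℂ] H) → Prop
  denseRange_of_intertwines : ∀ {H K : Type u}
    [NormedAddCommGroup H] [InnerProductSpace ℂ H] [CompleteSpace H]
    [NormedAddCommGroup K] [InnerProductSpace ℂ K] [CompleteSpace K]
    (T : H →L[ℂ] H) (S : K →L[ℂ] K), mem T → mem S →
    ∀ X : K →L[ℂ] H, T ∘L X = X ∘L S → X ≠ 0 → DenseRange X

/-- A backward weighted shift kills only the multiples of the zeroth basis vector. -/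
lemma IsBackwardWeightedShift.eq_smul_of_apply_eq_zero {H : Type*} [NormedAddCommGroup H]
    [InnerProductSpace ℂ H] {e : HilbertBasis ℕ ℂ H} {w : ℕ → ℂ} {T : H →L[ℂ] H}
    (hw : ∀ k, w k ≠ 0) (hT : IsBackwardWeightedShift e w T) {x : H} (hx : T x = 0) :
    ∃ c : ℂ, x = c • e 0 := by
  have hs := e.hasSum_repr x
  have hrepr : ∀ k, e.repr x (k + 1) = 0 := by
    intro k
    have h1 := (hs.mapL T).mapL (innerSL ℂ (e k))
    rw [hx, map_zero] at h1
    have h2 : ∀ j, j ≠ k + 1 → innerSL ℂ (e k) (T (e.repr x j • e j)) = 0 := by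
      intro j hj
      rcases j with _ | j
      · simp [hT.1]
      · have : k ≠ j := fun h => hj (by rw [h])
        simp [hT.2, e.orthonormal.inner_eq_zero this]
    have h3 := (hasSum_single (k + 1) h2).unique h1
    simpa [hT.2, inner_smul_right, e.orthonormal.1 k, hw k, inner_self_eq_norm_sq_to_K] using h3
  refine ⟨e.repr x 0, ?_⟩
  refine hs.unique (hasSum_single 0 ?_)
  intro j hj
  obtain ⟨k, rfl⟩ := Nat.exists_eq_succ_of_ne_zero hj
  simp [hrepr k]

/-- A nonzero intertwiner of two backward weighted shifts with nonzero weights has dense range. -/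
lemma IsBackwardWeightedShift.denseRange_of_intertwines {H K : Type*}
    [NormedAddCommGroup H] [InnerProductSpace ℂ H] [NormedAddCommGroup K] [InnerProductSpace ℂ K]
    {e : HilbertBasis ℕ ℂ H} {a : ℕ → ℂ} {A : H →L[ℂ] H}
    {f : HilbertBasis ℕ ℂ K} {b : ℕ → ℂ} {B : K →L[ℂ] K}
    (ha : ∀ k, a k ≠ 0) (hA : IsBackwardWeightedShift e a A)
    (hb : ∀ k, b k ≠ 0) (hB : IsBackwardWeightedShift f b B)
    (X : K →L[ℂ] H) (hX : A ∘L X = X ∘L B) (hX0 : X ≠ 0) : DenseRange X := by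
  have hX' : ∀ x, A (X x) = X (B x) := fun x => DFunLike.congr_fun hX x
  have hdf : Dense (Submodule.span ℂ (Set.range f) : Set K) :=
    (Submodule.dense_iff_topologicalClosure_eq_top).2 f.dense_span
  have hde : Dense (Submodule.span ℂ (Set.range e) : Set H) :=
    (Submodule.dense_iff_topologicalClosure_eq_top).2 e.dense_span
  have hex : ∃ q, X (f q) ≠ 0 := by
    by_contra! hcon
    apply hX0
    refine ContinuousLinearMap.ext_on hdf ?_
    rintro _ ⟨q, rfl⟩
    simpa using hcon q
  classical
  -- the image of the algebraic span of the basis contains every basis vector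
  set M : Submodule ℂ H := (Submodule.span ℂ (Set.range f)).map (X : K →ₗ[ℂ] H) with hM
  have hq0 : e 0 ∈ M := by
    have hne := Nat.find_spec hex
    have hmin : A (X (f (Nat.find hex))) = 0 := by
      rw [hX']
      rcases hq : Nat.find hex with _ | p
      · simp [hB.1]
      · have : X (f p) = 0 := by
          have := Nat.find_min hex (m := p) (by omega)
          simpa using this
        simp [hB.2, this]
    obtain ⟨c, hc⟩ := hA.eq_smul_of_apply_eq_zero ha hmin
    have hc0 : c ≠ 0 := by
      rintro rfl
      exact hne (by simpa using hc)
    have hmem : X (f (Nat.find hex)) ∈ M :=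
      Submodule.mem_map_of_mem (f := (X : K →ₗ[ℂ] H)) (Submodule.subset_span ⟨_, rfl⟩)
    rw [hc] at hmem
    exact (M.smul_mem_iff hc0).1 hmem
  have hlift : ∀ y ∈ Submodule.span ℂ (Set.range f),
      ∃ z ∈ Submodule.span ℂ (Set.range f), B z = y := by
    intro y hy
    have : Submodule.span ℂ (Set.range f) ≤
        (Submodule.span ℂ (Set.range f)).map (B : K →ₗ[ℂ] K) := by
      rw [Submodule.span_le]
      rintro _ ⟨k, rfl⟩
      refine ⟨(b k)⁻¹ • f (k + 1), Submodule.smul_mem _ _ (Submodule.subset_span ⟨_, rfl⟩), ?_⟩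
      simp [hB.2, smul_smul, inv_mul_cancel₀ (hb k)]
    obtain ⟨z, hz, hzy⟩ := this hy
    exact ⟨z, hz, hzy⟩
  have hall : ∀ m, e m ∈ M := by
    intro m
    induction m with
    | zero => exact hq0
    | succ m ih =>
      obtain ⟨y, hy, hye⟩ := ih
      obtain ⟨z, hz, hzy⟩ := hlift (a m • y) (Submodule.smul_mem _ _ hy)
      have hye' : X y = e m := hye
      have h0 : A (X z - e (m + 1)) = 0 := by
        rw [map_sub, hX', hzy, map_smul, hye', hA.2, sub_self]
      obtain ⟨c, hc⟩ := hA.eq_smul_of_apply_eq_zero ha h0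
      have hzM : X z ∈ M := Submodule.mem_map_of_mem (f := (X : K →ₗ[ℂ] H)) hz
      have : e (m + 1) = X z - c • e 0 := by rw [← hc]; abel
      rw [this]
      exact M.sub_mem hzM (M.smul_mem c hq0)
  refine hde.mono ?_
  intro x hx
  have hle : Submodule.span ℂ (Set.range e) ≤ M := by
    rw [Submodule.span_le]
    rintro _ ⟨m, rfl⟩
    exact hall m
  obtain ⟨y, -, hy⟩ := hle hx
  exact ⟨y, hy⟩

/-- The class of ONB shifts: the backward weighted shifts, with nonzero weights on some
orthonormal basis, that are not quasi-nilpotent. -/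
def onbShifts : OperatorClass where
  mem {H} _ _ _ T := ¬ IsQuasiNilpotent T ∧ ∃ (e : HilbertBasis ℕ ℂ H) (w : ℕ → ℂ),
    (∀ k, w k ≠ 0) ∧ IsBackwardWeightedShift e w T
  denseRange_of_intertwines := by
    rintro H K _ _ _ _ _ _ T S ⟨-, e, a, ha, hT⟩ ⟨-, f, b, hb, hS⟩ X hX hX0
    exact hT.denseRange_of_intertwines ha hb hS X hX hX0

/-- A topological direct decomposition `H = H₁ ∔ ⋯ ∔ Hₙ` (not necessarily orthogonal): a family of
subspaces for which `(x₁, …, xₙ) ↦ x₁ + ⋯ + xₙ` is a linear homeomorphism from the product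
onto `H`. -/
structure TopDecomposition (n : ℕ) (H : Type*) [NormedAddCommGroup H]
    [InnerProductSpace ℂ H] where
  space : Fin n → Submodule ℂ H
  sumEquiv : (∀ i, space i) ≃L[ℂ] H
  sumEquiv_apply : ∀ x, sumEquiv x = ∑ i, (x i : H)

namespace TopDecomposition

variable {n : ℕ} {H : Type*} [NormedAddCommGroup H] [InnerProductSpace ℂ H]

/-- The projection of `H` onto the `i`-th summand along the other ones. -/
def proj (D : TopDecomposition n H) (i : Fin n) : H →L[ℂ] D.space i :=
  (ContinuousLinearMap.proj i : (∀ i, D.space i) →L[ℂ] D.space i) ∘L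
    (D.sumEquiv.symm : H →L[ℂ] (∀ i, D.space i))

/-- The entry `T_{i,j} : H_j → H_i` of the operator matrix of `T`. -/
def block (D : TopDecomposition n H) (T : H →L[ℂ] H) (i j : Fin n) :
    D.space j →L[ℂ] D.space i :=
  D.proj i ∘L T ∘L (D.space j).subtypeL

lemma proj_coe (D : TopDecomposition n H) (i : Fin n) (x : D.space i) :
    D.proj i (x : H) = x := by
  have h : D.sumEquiv (Pi.single i x) = (x : H) := by
    rw [D.sumEquiv_apply, Finset.sum_eq_single i]
    · simp
    · intro j _ hj
      simp [Pi.single_eq_of_ne hj]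
    · simp
  simp [proj, ← h]

/-- The summands are Hilbert spaces. -/
instance [CompleteSpace H] (D : TopDecomposition n H) (i : Fin n) :
    CompleteSpace (D.space i) := by
  have h : (D.space i : Set H) = {x : H | ((D.proj i x : D.space i) : H) = x} := by
    ext x
    constructor
    · intro hx
      exact congrArg Subtype.val (D.proj_coe i ⟨x, hx⟩)
    · intro hx
      have hx' : ((D.proj i x : D.space i) : H) = x := hx
      rw [← hx']
      exact (D.proj i x).2
  have hc : IsClosed (D.space i : Set H) := by
    rw [h]
    exact isClosed_eq (by fun_prop) continuous_id
  exact hc.completeSpace_coe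

end TopDecomposition

/-- `T = ((T_{i,j}))`, written with respect to the decomposition `D`, is in `F_n(𝒜)`. -/
structure IsInF {n : ℕ} {H : Type*} [NormedAddCommGroup H] [InnerProductSpace ℂ H]
    [CompleteSpace H] (𝒜 : OperatorClass) (D : TopDecomposition n H) (T : H →L[ℂ] H) : Prop where
  upper : ∀ i j : Fin n, j < i → D.block T i j = 0
  diag_mem : ∀ i : Fin n, 𝒜.mem (D.block T i i)
  link_ne_zero : ∀ i j : Fin n, (j : ℕ) = i + 1 → D.block T i j ≠ 0
  flag : ∀ i j : Fin n, (j : ℕ) = i + 1 →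
    D.block T i i ∘L D.block T i j = D.block T i j ∘L D.block T j j

/-- `T = ((T_{i,j}))`, written with respect to the decomposition `D`, is in `OF_n(𝒜)`. -/
structure IsInOF {n : ℕ} {H : Type*} [NormedAddCommGroup H] [InnerProductSpace ℂ H]
    [CompleteSpace H] (𝒜 : OperatorClass) (D : TopDecomposition n H) (T : H →L[ℂ] H) : Prop
    extends IsInF 𝒜 D T where
  eq_zero_above : ∀ i j : Fin n, (i : ℕ) + 2 ≤ j → D.block T i j = 0

/-- If for every `ε > 0` the norms `‖P ^ m‖` are `O(ε ^ m)`, then `P` is quasi-nilpotent. -/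
lemma isQuasiNilpotent_of_norm_pow_le {H : Type*} [NormedAddCommGroup H] [InnerProductSpace ℂ H]
    {P : H →L[ℂ] H} (h : ∀ ε : ℝ, 0 < ε → ∃ K : ℝ, 0 < K ∧ ∀ m : ℕ, ‖P ^ m‖ ≤ K * ε ^ m) :
    IsQuasiNilpotent P := by
  unfold IsQuasiNilpotent
  rw [Metric.tendsto_atTop]
  intro ε hε
  -- Eventually `K ^ (1 / m) < 2`, so the rate `ε / 4` leaves a bound below `ε / 2`.
  obtain ⟨K, hK, hb⟩ := h (ε / 4) (by positivity)
  have hlim : Tendsto (fun m : ℕ => K ^ (1 / (m : ℝ))) atTop (𝓝 1) := by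
    have h1 : Tendsto (fun m : ℕ => 1 / (m : ℝ)) atTop (𝓝 0) := tendsto_one_div_atTop_nhds_zero_nat
    simpa using (tendsto_const_nhds (x := K)).rpow h1 (Or.inl hK.ne')
  obtain ⟨N, hN⟩ := eventually_atTop.1 (hlim.eventually (gt_mem_nhds (show (1 : ℝ) < 2 by norm_num)))
  refine ⟨max N 1, fun m hm => ?_⟩
  have hm0 : (m : ℝ) ≠ 0 := by
    have : 1 ≤ m := le_trans (le_max_right _ _) hm
    positivity
  have h2 := hN m (le_trans (le_max_left _ _) hm)
  have h3 : ‖P ^ m‖ ^ (1 / (m : ℝ)) ≤ K ^ (1 / (m : ℝ)) * (ε / 4) := by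
    calc ‖P ^ m‖ ^ (1 / (m : ℝ)) ≤ (K * (ε / 4) ^ m) ^ (1 / (m : ℝ)) :=
          Real.rpow_le_rpow (norm_nonneg _) (hb m) (by positivity)
      _ = K ^ (1 / (m : ℝ)) * (ε / 4) := by
          rw [Real.mul_rpow hK.le (by positivity), ← Real.rpow_natCast, ← Real.rpow_mul (by positivity),
            mul_one_div_cancel hm0, Real.rpow_one]
  rw [Real.dist_eq, sub_zero, abs_of_nonneg (by positivity)]
  nlinarith

/-- A bounded operator determined by scalars on a Hilbert basis: if the coordinates of `A x` are
those of `x`, shifted by `s` and multiplied by scalars bounded by `C`, then `‖A‖ ≤ C`. -/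
lemma norm_le_of_repr_shift {H K : Type*} [NormedAddCommGroup H] [InnerProductSpace ℂ H]
    [NormedAddCommGroup K] [InnerProductSpace ℂ K] (e : HilbertBasis ℕ ℂ H)
    (f : HilbertBasis ℕ ℂ K) {A : H →L[ℂ] K} {c : ℕ → ℂ} {C : ℝ} {s : ℕ} (hC : 0 ≤ C)
    (hc : ∀ l, ‖c l‖ ≤ C) (hA : ∀ x l, f.repr (A x) l = c l * e.repr x (l + s)) : ‖A‖ ≤ C := by
  refine A.opNorm_le_bound hC fun x => ?_
  have hp : 0 < (2 : ENNReal).toReal := by norm_num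
  have hsum := lp.hasSum_norm hp (e.repr x)
  have hsum' := lp.hasSum_norm hp (f.repr (A x))
  simp only [ENNReal.toReal_ofNat, Real.rpow_ofNat, LinearIsometryEquiv.norm_map] at hsum hsum'
  have hs : Summable fun l => ‖e.repr x (l + s)‖ ^ 2 := (summable_nat_add_iff s).2 hsum.summable
  have h1 : ∑' l, ‖e.repr x (l + s)‖ ^ 2 ≤ ‖x‖ ^ 2 := by
    rw [← hsum.tsum_eq, ← hsum.summable.sum_add_tsum_nat_add s]
    exact le_add_of_nonneg_left (Finset.sum_nonneg fun _ _ => by positivity)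
  have h2 : ‖A x‖ ^ 2 ≤ C ^ 2 * ∑' l, ‖e.repr x (l + s)‖ ^ 2 := by
    rw [← hsum'.tsum_eq, ← tsum_mul_left]
    refine hsum'.summable.tsum_le_tsum (fun l => ?_) (hs.mul_left _)
    rw [hA, norm_mul, mul_pow]
    gcongr
    exact hc l
  refine le_of_sq_le_sq ?_ (by positivity)
  rw [mul_pow]
  exact h2.trans (by gcongr)

namespace IsBackwardWeightedShift

variable {H : Type*} [NormedAddCommGroup H] [InnerProductSpace ℂ H]
  {e : HilbertBasis ℕ ℂ H} {w : ℕ → ℂ} {T : H →L[ℂ] H}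

lemma repr_apply (hT : IsBackwardWeightedShift e w T) (x : H) (l : ℕ) :
    e.repr (T x) l = w l * e.repr x (l + 1) := by
  have hs := ((e.hasSum_repr x).mapL T).mapL (innerSL ℂ (e l))
  have h2 : ∀ j, j ≠ l + 1 → innerSL ℂ (e l) (T (e.repr x j • e j)) = 0 := by
    intro j hj
    rcases j with _ | j
    · simp [hT.1]
    · have : l ≠ j := fun h => hj (by rw [h])
      simp [hT.2, e.orthonormal.inner_eq_zero this]
  have h3 := hs.unique (hasSum_single (l + 1) h2)
  rw [e.repr_apply_apply]
  simpa [hT.2, e.orthonormal.1 l, inner_self_eq_norm_sq_to_K, mul_comm] using h3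

/-- Reduces the norms of powers to uniform bounds on quotients of weight products. -/
lemma repr_pow_apply (hw : ∀ k, w k ≠ 0) (hT : IsBackwardWeightedShift e w T) (m : ℕ) (x : H)
    (l : ℕ) : e.repr ((T ^ m) x) l =
      ((∏ k ∈ Finset.range (l + m), w k) / ∏ k ∈ Finset.range l, w k) * e.repr x (l + m) := by
  have hp : ∀ l, ∏ k ∈ Finset.range l, w k ≠ 0 := fun l => Finset.prod_ne_zero_iff.2 fun k _ => hw k
  induction m generalizing x with
  | zero => simp [div_self (hp l)]
  | succ m ih =>
    rw [pow_succ, mul_apply_eq_comp, ih, hT.repr_apply, ← add_assoc,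
      Finset.prod_range_succ]
    ring

lemma norm_weight_le (hT : IsBackwardWeightedShift e w T) (k : ℕ) : ‖w k‖ ≤ ‖T‖ := by
  have := T.le_opNorm (e (k + 1))
  rwa [hT.2, norm_smul, e.orthonormal.1, e.orthonormal.1, mul_one, mul_one] at this

/-- If the ratios `β (l + D) / β l` of the weight products tend to zero, the shift is
quasi-nilpotent. -/
lemma isQuasiNilpotent (hw : ∀ k, w k ≠ 0) (hT : IsBackwardWeightedShift e w T) (D : ℕ)
    (hD : Tendsto (fun l => ‖∏ k ∈ Finset.range (l + (D + 1)), w k‖ / ‖∏ k ∈ Finset.range l, w k‖)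
      atTop (𝓝 0)) : IsQuasiNilpotent T := by
  have hp : ∀ l, 0 < ‖∏ k ∈ Finset.range l, w k‖ := fun l =>
    norm_pos_iff.2 (Finset.prod_ne_zero_iff.2 fun k _ => hw k)
  refine isQuasiNilpotent_of_norm_pow_le fun ε hε => ?_
  set β : ℕ → ℝ := fun l => ‖∏ k ∈ Finset.range l, w k‖ with hβ
  -- `M` bounds all weights, and `M / ε ≥ 1` lets surplus factors be absorbed into a higher power of
  -- `M / ε`.
  set M := max ‖T‖ ε with hM
  have hMε : 1 ≤ M / ε := (one_le_div hε).2 (le_max_right _ _)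
  have hM0 : 0 < M := lt_of_lt_of_le hε (le_max_right _ _)
  have hMm : ∀ m, M ^ m = (M / ε) ^ m * ε ^ m := fun m => by
    rw [← mul_pow, div_mul_cancel₀ _ hε.ne']
  have hstep : ∀ m l, β (l + m) ≤ M ^ m * β l := by
    intro m l
    induction m with
    | zero => simp
    | succ m ih =>
      have : β (l + (m + 1)) = β (l + m) * ‖w (l + m)‖ := by
        simp only [hβ, ← add_assoc, Finset.prod_range_succ, norm_mul]
      rw [this, pow_succ, mul_right_comm]
      gcongr
      exact (hT.norm_weight_le _).trans (le_max_left _ _)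
  obtain ⟨N, hN⟩ := eventually_atTop.1
    (hD.eventually (ge_mem_nhds (show (0 : ℝ) < ε ^ (D + 1) by positivity)))
  have hN' : ∀ l, N ≤ l → β (l + (D + 1)) ≤ ε ^ (D + 1) * β l := fun l hl =>
    (div_le_iff₀ (hp l)).1 (hN l hl)
  -- Beyond `N`, strides of length `D + 1` gain `ε ^ (D + 1)` each; at most `D` remaining steps cost
  -- `M / ε` apiece.
  have hfar : ∀ m l, N ≤ l → β (l + m) ≤ (M / ε) ^ D * ε ^ m * β l := by
    intro m
    induction m using Nat.strong_induction_on with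
    | _ m ih =>
      intro l hl
      rcases lt_or_ge D m with hm | hm
      · obtain ⟨a, rfl⟩ : ∃ a, m = a + (D + 1) := ⟨m - (D + 1), by omega⟩
        rw [← add_assoc]
        calc β (l + a + (D + 1)) ≤ ε ^ (D + 1) * β (l + a) := hN' _ (by omega)
          _ ≤ ε ^ (D + 1) * ((M / ε) ^ D * ε ^ a * β l) := by
              gcongr; exact ih a (by omega) l hl
          _ = _ := by ring
      · refine (hstep m l).trans ?_
        rw [hMm]
        have : 0 ≤ β l := (hp l).le
        gcongr
  -- Crossing the initial segment below `N` costs at most another `(M / ε) ^ N`.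
  have hall : ∀ m l, β (l + m) ≤ (M / ε) ^ (D + N) * ε ^ m * β l := by
    intro m l
    have h0 : 0 ≤ β l := (hp l).le
    rcases lt_or_ge m N with hm | hm
    · refine (hstep m l).trans ?_
      rw [hMm]
      gcongr
      · omega
    · obtain ⟨a, rfl⟩ := Nat.exists_eq_add_of_le hm
      rw [← add_assoc]
      calc β (l + N + a) ≤ (M / ε) ^ D * ε ^ a * β (l + N) := hfar a _ (by omega)
        _ ≤ (M / ε) ^ D * ε ^ a * (M ^ N * β l) := by gcongr; exact hstep N l
        _ = _ := by rw [hMm]; ring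
  refine ⟨(M / ε) ^ (D + N), by positivity, fun m => ?_⟩
  refine norm_le_of_repr_shift e e (by positivity) (fun l => ?_) (hT.repr_pow_apply hw m)
  rw [norm_div, div_le_iff₀ (hp l)]
  exact hall m l

end IsBackwardWeightedShift

/-! ### Growth along diagonals in chains of commutators. -/

lemma tendsto_atTop_of_one_le_sub {f : ℕ → ℝ} (h : ∀ᶠ l in atTop, 1 ≤ f (l + 1) - f l) :
    Tendsto f atTop atTop := by
  obtain ⟨N, hN⟩ := eventually_atTop.1 h
  rw [← tendsto_add_atTop_iff_nat N]
  have hb : ∀ l : ℕ, (l : ℝ) + f N ≤ f (l + N) := by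
    intro l
    induction l with
    | zero => simp
    | succ l ih =>
      have := hN (l + N) (by omega)
      rw [show l + 1 + N = l + N + 1 by ring]
      push_cast
      linarith
  exact tendsto_atTop_mono hb (tendsto_atTop_add_const_right _ _ tendsto_natCast_atTop_atTop)

/-- Iterated sums of a nonzero constant are unbounded. -/
lemma tendsto_norm_atTop_of_iterated_sum {u : ℕ → ℕ → ℂ} {c : ℂ} (hc : c ≠ 0)
    (h0 : ∀ l, u 0 l = c) {N : ℕ}
    (h : ∀ q < N, ∀ l, u (q + 1) (l + 1) = u (q + 1) l + u q (l + 1)) {q : ℕ} (hq : q < N) :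
    Tendsto (fun l => ‖u (q + 1) l‖) atTop atTop := by
  -- After division by `c` the lowest level is `1`; real parts then have increments eventually at
  -- least `1` at every level.
  have key : ∀ q < N, Tendsto (fun l => (u (q + 1) l / c).re) atTop atTop := by
    intro q hq
    have hstep : ∀ q < N, ∀ l, (u (q + 1) (l + 1) / c).re - (u (q + 1) l / c).re =
        (u q (l + 1) / c).re := fun q hq l => by
      rw [h q hq, add_div, Complex.add_re]; ring
    induction q with
    | zero =>
      refine tendsto_atTop_of_one_le_sub (Eventually.of_forall fun l => ?_)
      rw [hstep 0 hq, h0, div_self hc, Complex.one_re]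
    | succ q ih =>
      refine tendsto_atTop_of_one_le_sub ?_
      have := (tendsto_add_atTop_iff_nat 1).2 (ih (by omega))
      filter_upwards [this.eventually_ge_atTop 1] with l hl
      rwa [hstep (q + 1) hq]
  have hpos : 0 < ‖c‖ := norm_pos_iff.2 hc
  refine tendsto_atTop_mono (fun l => ?_) ((key q hq).atTop_mul_const hpos)
  have := Complex.re_le_norm (u (q + 1) l / c)
  rwa [norm_div, le_div_iff₀ hpos] at this

/-- The behaviour on one diagonal of the last member of a chain `b 0, …, b r` of infinite matrices
in which every commutator with the backward shift is the preceding member. -/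
lemma exists_diagonal_growth {b : ℕ → ℕ → ℕ → ℂ} {r : ℕ}
    (hb : ∀ j ≤ r, ∀ l k, b j (l + 1) (k + 1) = b j l k + if j = 0 then 0 else b (j - 1) l (k + 1))
    (hb0 : ∀ j ≤ r, ∀ l, b j (l + 1) 0 = if j = 0 then 0 else b (j - 1) l 0)
    (hne : ∃ j, j ≤ r ∧ ∃ l k, b j l k ≠ 0) :
    ∃ p q d, p + q = r ∧ (∀ j < p, ∀ l k, b j l k = 0) ∧
      (∃ ε > 0, ∀ᶠ l in atTop, ε ≤ ‖b r (l + q) (l + d)‖) ∧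
      (q ≠ 0 → Tendsto (fun l => ‖b r (l + q) (l + d)‖) atTop atTop) := by
  classical
  obtain ⟨p, ⟨hpr, l₀, k₀, hlk⟩, hmin⟩ : ∃ p, (p ≤ r ∧ ∃ l k, b p l k ≠ 0) ∧
      ∀ j < p, ∀ l k, b j l k = 0 := by
    refine ⟨Nat.find hne, Nat.find_spec hne, fun j hj l k => ?_⟩
    have h1 := Nat.find_min hne hj
    by_contra h2
    exact h1 ⟨hj.le.trans (Nat.find_spec hne).1, l, k, h2⟩
  have hprev : ∀ l k, (if p = 0 then 0 else b (p - 1) l k) = 0 := by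
    intro l k
    split_ifs with h
    · rfl
    · exact hmin _ (by omega) l k
  have hdiag : ∀ s l k, b p (l + s) (k + s) = b p l k := by
    intro s l k
    induction s with
    | zero => rfl
    | succ s ih => rw [← add_assoc, ← add_assoc, hb p hpr, hprev, add_zero, ih]
  -- `b p` is constant along diagonals. Below the main diagonal these lead back to column `0`, where
  -- the entries vanish, so a nonzero entry lies on or above it and can be moved to row `0`.
  obtain ⟨d, hd⟩ : ∃ d, b p 0 d ≠ 0 := by
    rcases lt_or_ge k₀ l₀ with h | h
    · obtain ⟨a, rfl⟩ : ∃ a, l₀ = (a + 1) + k₀ := ⟨l₀ - k₀ - 1, by omega⟩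
      have := hdiag k₀ (a + 1) 0
      rw [zero_add, hb0 p hpr, hprev] at this
      exact absurd this hlk
    · obtain ⟨a, rfl⟩ := Nat.exists_eq_add_of_le' h
      refine ⟨a, ?_⟩
      rwa [← hdiag l₀, zero_add]
  obtain ⟨q, rfl⟩ := Nat.exists_eq_add_of_le hpr
  -- Moving one row further down at each level turns the recursion into `u (s + 1) (l + 1) = u (s +
  -- 1) l + u s (l + 1)`, a plain summation.
  set u : ℕ → ℕ → ℂ := fun q l => b (p + q) (l + q) (l + d) with hu
  have hu0 : ∀ l, u 0 l = b p 0 d := by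
    intro l
    have := hdiag l 0 d
    simpa [hu, add_comm d l] using this
  have hustep : ∀ s < q, ∀ l, u (s + 1) (l + 1) = u (s + 1) l + u s (l + 1) := by
    intro s hs l
    have := hb (p + (s + 1)) (by omega) (l + (s + 1)) (l + d)
    simp only [hu]
    rw [show l + 1 + (s + 1) = l + (s + 1) + 1 by ring, show l + 1 + d = l + d + 1 by ring, this,
      if_neg (by omega), show p + (s + 1) - 1 = p + s by omega,
      show l + 1 + s = l + (s + 1) by ring]
  have htend : q ≠ 0 → Tendsto (fun l => ‖u q l‖) atTop atTop := by
    intro hq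
    obtain ⟨s, rfl⟩ := Nat.exists_eq_succ_of_ne_zero hq
    exact tendsto_norm_atTop_of_iterated_sum hd hu0 hustep (Nat.lt_succ_self s)
  refine ⟨p, q, d, rfl, hmin, ?_, htend⟩
  rcases eq_or_ne q 0 with rfl | hq
  · exact ⟨‖b p 0 d‖, norm_pos_iff.2 hd, Eventually.of_forall fun l => (congrArg norm (hu0 l)).ge⟩
  · exact ⟨1, one_pos, (htend hq).eventually_ge_atTop 1⟩


/-! ### Normalised coordinates, kernel vectors and matrices of intertwiners. -/

/-- Coordinates for an operator `T` in which `T` is the sum of `n` unweighted backward shifts and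
of the identity links between consecutive ones: `T (vec j k) = vec j (k - 1) + vec (j - 1) k`. The
norms of the vectors and the coordinate functionals are controlled by `β`. -/
structure ShiftCoordinates {H : Type*} [NormedAddCommGroup H] [InnerProductSpace ℂ H]
    (n : ℕ) (T : H →L[ℂ] H) (β : ℕ → ℕ → ℂ) where
  vec : ℕ → ℕ → H
  coord : ℕ → ℕ → H →L[ℂ] ℂ
  coord_vec : ∀ i j l k, i < n → j < n → coord i l (vec j k) = if i = j ∧ l = k then 1 else 0
  coord_eq_zero : ∀ i l, n ≤ i → coord i l = 0
  eq_zero_of_coord : ∀ x, (∀ i l, coord i l x = 0) → x = 0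
  coord_apply : ∀ i l x, coord i l (T x) = coord i (l + 1) x + coord (i + 1) l x
  bound : ℝ
  norm_coord_le : ∀ i l, i < n → ‖coord i l‖ ≤ bound * ‖β i l‖
  norm_vec_le : ∀ j k, j < n → ‖vec j k‖ * ‖β j k‖ ≤ 1

namespace ShiftCoordinates

variable {H K : Type*} [NormedAddCommGroup H] [InnerProductSpace ℂ H]
  [NormedAddCommGroup K] [InnerProductSpace ℂ K] {n : ℕ} {T : H →L[ℂ] H} {S : K →L[ℂ] K}
  {β γ : ℕ → ℕ → ℂ}

lemma ext_coord (C : ShiftCoordinates n T β) {x y : H}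
    (h : ∀ i < n, ∀ l, C.coord i l x = C.coord i l y) : x = y := by
  refine sub_eq_zero.1 (C.eq_zero_of_coord _ fun i l => ?_)
  rcases lt_or_ge i n with hi | hi
  · rw [map_sub, h i hi, sub_self]
  · simp [C.coord_eq_zero i l hi]

lemma apply_vec (C : ShiftCoordinates n T β) {j : ℕ} (hj : j < n) (k : ℕ) :
    T (C.vec j k) = (if k = 0 then 0 else C.vec j (k - 1)) +
      if j = 0 then 0 else C.vec (j - 1) k := by
  refine C.ext_coord fun i hi l => ?_
  have h2 : C.coord (i + 1) l (C.vec j k) = if i + 1 = j ∧ l = k then 1 else 0 := by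
    rcases lt_or_ge (i + 1) n with h | h
    · exact C.coord_vec _ _ _ _ h hj
    · rw [C.coord_eq_zero _ _ h, if_neg (by omega)]; rfl
  rw [C.coord_apply, C.coord_vec _ _ _ _ hi hj, h2, map_add]
  congr 1
  · rcases k with _ | k
    · simp
    · simp [C.coord_vec _ _ _ _ hi hj]
  · rcases j with _ | j
    · simp
    · simp [C.coord_vec _ _ _ _ hi (show j < n by omega)]

/-- A vector of the kernel is determined by its zeroth coordinates. -/
lemma eq_zero_of_apply_eq_zero (C : ShiftCoordinates n T β) {x : H} (hx : T x = 0)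
    (h0 : ∀ i < n, C.coord i 0 x = 0) : x = 0 := by
  refine C.eq_zero_of_coord x fun i l => ?_
  induction l generalizing i with
  | zero =>
    rcases lt_or_ge i n with hi | hi
    · exact h0 i hi
    · simp [C.coord_eq_zero i 0 hi]
  | succ l ih =>
    have := C.coord_apply i l x
    rw [hx, map_zero, ih (i + 1), add_zero] at this
    exact this.symm

/-- The vectors `∑ s ≤ j, (-1) ^ s • vec (j - s) s` of the kernel. -/
noncomputable def kerVec (C : ShiftCoordinates n T β) (j : ℕ) : H :=
  ∑ s ∈ Finset.range (j + 1), (-1 : ℂ) ^ s • C.vec (j - s) s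

/-- Telescoping: the link term of each summand cancels the shift term of the next one, thanks to the
alternating signs. -/
lemma apply_kerVec (C : ShiftCoordinates n T β) {j : ℕ} (hj : j < n) : T (C.kerVec j) = 0 := by
  have h : ∀ m ≤ j, T (∑ s ∈ Finset.range m, (-1 : ℂ) ^ s • C.vec (j - s) s) =
      if m = 0 then 0 else (-1 : ℂ) ^ (m - 1) • C.vec (j - m) (m - 1) := by
    intro m hm
    induction m with
    | zero => simp
    | succ m ih =>
      rw [Finset.sum_range_succ, map_add, ih (by omega), map_smul, C.apply_vec (by omega)]
      rcases m with _ | m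
      · simp [show j ≠ 0 by omega]
      · have h1 : j - (m + 1) ≠ 0 := by omega
        have h2 : j - (m + 1) - 1 = j - (m + 1 + 1) := by omega
        simp only [Nat.add_eq_zero_iff, one_ne_zero, and_false, if_false, Nat.add_sub_cancel, h1, h2,
          smul_add, pow_succ]
        module
  rw [kerVec, Finset.sum_range_succ, map_add, h j le_rfl, map_smul, C.apply_vec (by omega)]
  rcases j with _ | j
  · simp
  · simp [pow_succ]

lemma coord_zero_kerVec (C : ShiftCoordinates n T β) {i j : ℕ} (hi : i < n) (hj : j < n) :
    C.coord i 0 (C.kerVec j) = if i = j then 1 else 0 := by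
  rw [kerVec, map_sum, Finset.sum_range_succ', Finset.sum_eq_zero, zero_add]
  · simp [C.coord_vec _ _ _ _ hi hj]
  · intro s _
    simp [C.coord_vec _ _ _ _ hi (show j - (s + 1) < n by omega)]

/-- An injective intertwiner cannot map the first `r + 1` kernel vectors to vectors whose zeroth
coordinates vanish from the index `r` on. -/
lemma exists_coord_kerVec_ne_zero (C : ShiftCoordinates n T β) (E : ShiftCoordinates n S γ)
    {X : H →L[ℂ] K} (hX : Function.Injective X) (hXT : ∀ x, X (T x) = S (X x)) {r : ℕ}
    (hr : r < n) : ∃ i j, r ≤ i ∧ i < n ∧ j ≤ r ∧ E.coord i 0 (X (C.kerVec j)) ≠ 0 := by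
  by_contra! hcon
  let V : (Fin (r + 1) → ℂ) →ₗ[ℂ] H := Fintype.linearCombination ℂ fun j => C.kerVec j
  -- The zeroth coordinates below `r` map `r + 1` parameters to `r` numbers, so some nonzero
  -- combination of kernel vectors is killed; under `hcon` its image has no other zeroth
  -- coordinates.
  let Φ : (Fin (r + 1) → ℂ) →ₗ[ℂ] (Fin r → ℂ) :=
    LinearMap.pi fun i => (E.coord i 0 : K →ₗ[ℂ] ℂ) ∘ₗ (X : H →ₗ[ℂ] K) ∘ₗ V
  have hV : ∀ a, V a = ∑ j, a j • C.kerVec j := fun a => Fintype.linearCombination_apply ..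
  obtain ⟨a, ha, ha0⟩ := (Submodule.ne_bot_iff _).1
    (LinearMap.ker_ne_bot_of_finrank_lt (f := Φ) (by simp))
  have hTV : T (V a) = 0 := by
    rw [hV, map_sum]
    exact Finset.sum_eq_zero fun j _ => by rw [map_smul, C.apply_kerVec (by omega), smul_zero]
  have hXV : X (V a) = 0 := by
    refine E.eq_zero_of_apply_eq_zero (by rw [← hXT, hTV, map_zero]) fun i hi => ?_
    rcases lt_or_ge i r with h | h
    · exact congrFun ha ⟨i, h⟩
    · rw [hV, map_sum, map_sum]
      exact Finset.sum_eq_zero fun j _ => by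
        rw [map_smul, map_smul, hcon i j h hi (by omega), smul_zero]
  have hVa : V a = 0 := hX (by rw [hXV, map_zero])
  refine ha0 (funext fun j => ?_)
  have h1 := congrArg (C.coord j 0) hVa
  rw [hV, map_sum, map_zero, Finset.sum_eq_single j] at h1
  · rw [map_smul, C.coord_zero_kerVec (by omega) (by omega), if_pos rfl] at h1
    simpa using h1
  · intro b _ hb
    rw [map_smul, C.coord_zero_kerVec (by omega) (by omega), if_neg, smul_zero]
    exact fun h => hb (Fin.ext h.symm)
  · simp

/-- The entries of the matrix of `X`. -/
noncomputable def entry (C : ShiftCoordinates n T β) (E : ShiftCoordinates n S γ) (X : H →L[ℂ] K)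
    (i j l k : ℕ) : ℂ := E.coord i l (X (C.vec j k))

/-- The intertwining relation read entrywise; it no longer involves the weights. -/
lemma entry_add (C : ShiftCoordinates n T β) (E : ShiftCoordinates n S γ) {X : H →L[ℂ] K}
    (hXT : ∀ x, X (T x) = S (X x)) (i : ℕ) {j : ℕ} (hj : j < n) (l k : ℕ) :
    C.entry E X i j (l + 1) k + C.entry E X (i + 1) j l k =
      (if k = 0 then 0 else C.entry E X i j l (k - 1)) +
        if j = 0 then 0 else C.entry E X i (j - 1) l k := by
  have := congrArg (E.coord i l) (hXT (C.vec j k))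
  rw [E.coord_apply, C.apply_vec hj, map_add, map_add] at this
  simp only [entry]
  rw [← this]
  split_ifs <;> simp

/-- The weights return only here: boundedness of `X` limits an entry by a quotient of weight
products. -/
lemma norm_entry_mul_le (C : ShiftCoordinates n T β) (E : ShiftCoordinates n S γ) (X : H →L[ℂ] K)
    {i j : ℕ} (hi : i < n) (hj : j < n) (l k : ℕ) :
    ‖C.entry E X i j l k‖ * ‖β j k‖ ≤ E.bound * ‖X‖ * ‖γ i l‖ := by
  have h1 : ‖C.entry E X i j l k‖ ≤ ‖E.coord i l‖ * (‖X‖ * ‖C.vec j k‖) :=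
    ((E.coord i l).le_opNorm _).trans (by gcongr; exact X.le_opNorm _)
  calc ‖C.entry E X i j l k‖ * ‖β j k‖
      ≤ ‖E.coord i l‖ * (‖X‖ * ‖C.vec j k‖) * ‖β j k‖ := by gcongr
    _ = ‖E.coord i l‖ * ‖X‖ * (‖C.vec j k‖ * ‖β j k‖) := by ring
    _ ≤ ‖E.coord i l‖ * ‖X‖ * 1 := by gcongr; exact C.norm_vec_le j k hj
    _ ≤ E.bound * ‖γ i l‖ * ‖X‖ := by rw [mul_one]; gcongr; exact E.norm_coord_le i l hi
    _ = _ := by ring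

/-! ### Triangularity of intertwiners and comparison of weight products. -/

/-- If all rows below row `r` vanish left of the diagonal, then so does row `r`, unless its
diagonal entry is unbounded along some diagonal. -/
lemma exists_entry_growth (C : ShiftCoordinates n T β) (E : ShiftCoordinates n S γ)
    {X : H →L[ℂ] K} (hX : Function.Injective X) (hXT : ∀ x, X (T x) = S (X x)) {r : ℕ}
    (hr : r < n) (hbelow : ∀ i, r < i → i < n → ∀ j < i, ∀ l k, C.entry E X i j l k = 0) :
    ∃ p q d, p + q = r ∧ (∀ j < p, ∀ l k, C.entry E X r j l k = 0) ∧
      (∃ ε > 0, ∀ᶠ l in atTop, ε ≤ ‖C.entry E X r r (l + q) (l + d)‖) ∧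
      (q ≠ 0 → Tendsto (fun l => ‖C.entry E X r r (l + q) (l + d)‖) atTop atTop) := by
  have hnext : ∀ j ≤ r, ∀ l k, C.entry E X (r + 1) j l k = 0 := by
    intro j hj l k
    rcases lt_or_ge (r + 1) n with h | h
    · exact hbelow (r + 1) (by omega) h j (by omega) l k
    · simp [entry, E.coord_eq_zero _ _ h]
  refine exists_diagonal_growth (fun j hj l k => ?_) (fun j hj l => ?_) ?_
  · have := C.entry_add E hXT r (show j < n by omega) l (k + 1)
    simpa [hnext j hj] using this
  · have := C.entry_add E hXT r (show j < n by omega) l 0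
    simpa [hnext j hj] using this
  -- If row `r` vanished up to its diagonal block, the images of `kerVec 0`, …, `kerVec r` would
  -- have no zeroth coordinates from `r` on.
  · by_contra! hcon
    obtain ⟨i, j, hri, hi, hj, hne⟩ := C.exists_coord_kerVec_ne_zero E hX hXT hr
    refine hne ?_
    rw [kerVec, map_sum, map_sum]
    refine Finset.sum_eq_zero fun s _ => ?_
    rw [map_smul, map_smul]
    change _ • C.entry E X i (j - s) 0 s = 0
    rcases eq_or_lt_of_le hri with rfl | h
    · rw [hcon _ (by omega), smul_zero]
    · rw [hbelow i h hi _ (by omega), smul_zero]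

/-- Conflicting growth of two intertwiners forces the ratios of `β` to tend to zero. -/
lemma tendsto_ratio_of_growth {b c : ℕ → ℝ} (hb : ∀ l, 0 < b l) {M : ℝ}
    (hM : ∀ l, b (l + 1) ≤ M * b l) {A B : ℝ} {x y : ℕ → ℝ} {q d q' d' : ℕ} {δ ε : ℝ}
    (hc : ∀ l, 0 ≤ c l) (hδ : 0 < δ) (hε : 0 < ε)
    (hx : ∀ l, x l * b (l + d) ≤ A * c (l + q)) (hy : ∀ l, y l * c (l + d') ≤ B * b (l + q'))
    (hxδ : ∀ᶠ l in atTop, δ ≤ x l) (hyε : ∀ᶠ l in atTop, ε ≤ y l)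
    (hinf : Tendsto x atTop atTop ∨ Tendsto y atTop atTop) :
    Tendsto (fun l => b (l + (d + d' + 1)) / b l) atTop (𝓝 0) := by
  have hM0 : 0 ≤ M := by
    have h1 := (hb 1).trans_le (hM 0)
    exact (pos_of_mul_pos_left h1 (hb 0).le).le
  have hstep : ∀ m l, b (l + m) ≤ M ^ m * b l := by
    intro m l
    induction m with
    | zero => simp
    | succ m ih =>
      calc b (l + m + 1) ≤ M * b (l + m) := hM _
        _ ≤ M * (M ^ m * b l) := by gcongr
        _ = _ := by ring
  -- The two arguments are chosen so that both estimates involve the same value `c (l + d' + q)`,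
  -- which then cancels.
  set z : ℕ → ℝ := fun l => x (l + d') * y (l + q) with hz
  have hx' := (tendsto_add_atTop_nat d').eventually hxδ
  have hy' := (tendsto_add_atTop_nat q).eventually hyε
  have hzinf : Tendsto z atTop atTop := by
    rcases hinf with h | h
    · refine tendsto_atTop_mono' _ ?_ ((h.comp (tendsto_add_atTop_nat d')).atTop_mul_const hε)
      filter_upwards [hx', hy'] with l h1 h2
      exact mul_le_mul_of_nonneg_left h2 (hδ.le.trans h1)
    · refine tendsto_atTop_mono' _ ?_ ((h.comp (tendsto_add_atTop_nat q)).const_mul_atTop hδ)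
      filter_upwards [hx', hy'] with l h1 h2
      exact mul_le_mul_of_nonneg_right h1 (hε.le.trans h2)
  -- The power of `M` pays for advancing `b` by `q + q' + 1` places. The extra place keeps the final
  -- lag `d + d' + 1` positive.
  set R := |A| * |B| * M ^ (q + q' + 1) with hR
  have hmain : ∀ᶠ l in atTop, b (l + (q + q') + (d + d' + 1)) / b (l + (q + q')) ≤ R / z l := by
    filter_upwards [hx', hy'] with l h1 h2
    have hx0 : 0 < x (l + d') := hδ.trans_le h1
    have hy0 : 0 < y (l + q) := hε.trans_le h2
    have e1 : x (l + d') * b (l + d' + d) ≤ |A| * c (l + d' + q) :=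
      (hx _).trans (by gcongr; exacts [hc _, le_abs_self A])
    have e2 : y (l + q) * c (l + q + d') ≤ |B| * b (l + q + q') :=
      (hy _).trans (by gcongr; exacts [(hb _).le, le_abs_self B])
    rw [show l + q + d' = l + d' + q by ring] at e2
    rw [div_le_div_iff₀ (hb _) (mul_pos hx0 hy0)]
    calc b (l + (q + q') + (d + d' + 1)) * z l
        = b (l + d' + d + (q + q' + 1)) * z l := by congr 2; ring
      _ ≤ M ^ (q + q' + 1) * b (l + d' + d) * z l := by
          gcongr
          exact hstep _ _
      _ = M ^ (q + q' + 1) * y (l + q) * (x (l + d') * b (l + d' + d)) := by rw [hz]; ring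
      _ ≤ M ^ (q + q' + 1) * y (l + q) * (|A| * c (l + d' + q)) := by gcongr
      _ = M ^ (q + q' + 1) * |A| * (y (l + q) * c (l + d' + q)) := by ring
      _ ≤ M ^ (q + q' + 1) * |A| * (|B| * b (l + q + q')) := by gcongr
      _ = R * b (l + (q + q')) := by rw [hR, ← add_assoc]; ring
  refine (tendsto_add_atTop_iff_nat (q + q')).1 ?_
  refine squeeze_zero' (Eventually.of_forall fun l => (div_pos (hb _) (hb _)).le) hmain ?_
  exact tendsto_const_nhds.div_atTop hzinf

/-- The diagonal coefficients of mutually intertwined operators are comparable. -/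
theorem exists_norm_le (C : ShiftCoordinates n T β) (E : ShiftCoordinates n S γ)
    {X : H →L[ℂ] K} (hX : Function.Injective X) (hXT : ∀ x, X (T x) = S (X x))
    {Y : K →L[ℂ] H} (hY : Function.Injective Y) (hYS : ∀ x, Y (S x) = T (Y x))
    (hβ : ∀ i l, β i l ≠ 0) {M : ℕ → ℝ} (hM : ∀ i < n, ∀ l, ‖β i (l + 1)‖ ≤ M i * ‖β i l‖)
    (hnq : ∀ i < n, ∀ D, ¬ Tendsto (fun l => ‖β i (l + (D + 1))‖ / ‖β i l‖) atTop (𝓝 0)) :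
    ∀ i < n, ∃ B : ℝ, ∀ l, ‖β i l‖ ≤ B * ‖γ i l‖ := by
  have htri : ∀ s ≤ n, ∀ i, n - s ≤ i → i < n → ∀ j < i, ∀ l k,
      C.entry E X i j l k = 0 ∧ E.entry C Y i j l k = 0 := by
    intro s hs
    induction s with
    | zero => intro i h1 h2; omega
    | succ s ih =>
      intro r h1 hr
      rcases lt_or_ge r (n - s) with h | h
      swap
      · exact ih (by omega) r h hr
      obtain ⟨p, q, d, hpq, hp, ⟨δ, hδ, hxδ⟩, hinf⟩ := C.exists_entry_growth E hX hXT hr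
        fun i h1 h2 j hj l k => (ih (by omega) i (by omega) h2 j hj l k).1
      obtain ⟨p', q', d', hpq', hp', ⟨ε, hε, hyε⟩, hinf'⟩ := E.exists_entry_growth C hY hYS hr
        fun i h1 h2 j hj l k => (ih (by omega) i (by omega) h2 j hj l k).2
      -- Blow-up for either intertwiner contradicts `hnq`. So `q = q' = 0`, and the first nonzero
      -- block of row `r` is the diagonal one for both.
      have hqq : ¬ (q ≠ 0 ∨ q' ≠ 0) := fun hne =>
        hnq r hr (d + d') (tendsto_ratio_of_growth (fun l => norm_pos_iff.2 (hβ r l)) (hM r hr)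
          (c := fun l => ‖γ r l‖) (fun l => norm_nonneg _) hδ hε
          (fun l => C.norm_entry_mul_le E X hr hr (l + q) (l + d))
          (fun l => E.norm_entry_mul_le C Y hr hr (l + q') (l + d')) hxδ hyε
          (hne.imp hinf hinf'))
      intro j hj l k
      exact ⟨hp j (by omega) l k, hp' j (by omega) l k⟩
  have hzero : ∀ i < n, ∀ j < i, ∀ l k, C.entry E X i j l k = 0 := fun i hi j hj l k =>
    (htri n le_rfl i (by omega) hi j hj l k).1
  intro r hr
  have hnext : ∀ j ≤ r, ∀ l k, C.entry E X (r + 1) j l k = 0 := by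
    intro j hj l k
    rcases lt_or_ge (r + 1) n with h | h
    · exact hzero (r + 1) h j (by omega) l k
    · simp [entry, E.coord_eq_zero _ _ h]
  -- By triangularity both link terms drop out, so the diagonal block commutes with the unweighted
  -- shift.
  have hdiag : ∀ l, C.entry E X r r l l = C.entry E X r r 0 0 := by
    intro l
    induction l with
    | zero => rfl
    | succ l ih =>
      have := C.entry_add E hXT r hr l (l + 1)
      rw [hnext r le_rfl, add_zero, if_neg (by omega), Nat.add_sub_cancel, ih] at this
      rw [this]
      split_ifs with h0
      · rw [add_zero]
      · rw [hzero r hr (r - 1) (by omega), add_zero]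
  have hne : C.entry E X r r 0 0 ≠ 0 := by
    intro h0
    obtain ⟨i, j, hri, hi, hj, hne⟩ := C.exists_coord_kerVec_ne_zero E hX hXT hr
    refine hne ?_
    rw [kerVec, map_sum, map_sum]
    refine Finset.sum_eq_zero fun s _ => ?_
    rw [map_smul, map_smul]
    change _ • C.entry E X i (j - s) 0 s = 0
    -- Off the lower triangle only `i = j = r`, `s = 0` survives, and `h0` kills it; the rest
    -- excludes truncated subtraction.
    by_cases h : j - s < i
    · rw [hzero i hi _ h, smul_zero]
    · obtain rfl : i = r := by omega
      obtain rfl : j = i := by omega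
      rcases Nat.eq_zero_or_pos s with rfl | hs
      · rw [Nat.sub_zero, h0, smul_zero]
      · obtain rfl : j = 0 := by omega
        have hs0 : s = 0 := by
          have := Finset.mem_range.1 ‹_›
          omega
        omega
  refine ⟨E.bound * ‖X‖ / ‖C.entry E X r r 0 0‖, fun l => ?_⟩
  have := C.norm_entry_mul_le E X hr hr l l
  rw [hdiag] at this
  rw [div_mul_eq_mul_div, le_div_iff₀ (norm_pos_iff.2 hne), mul_comm]
  exact this

end ShiftCoordinates


/-! ### Diagonal operators between Hilbert bases. -/

namespace HilbertBasis

variable {H K : Type*} [NormedAddCommGroup H] [InnerProductSpace ℂ H]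
  [NormedAddCommGroup K] [InnerProductSpace ℂ K]

lemma continuousLinearMap_ext (e : HilbertBasis ℕ ℂ H) {A B : H →L[ℂ] K}
    (h : ∀ k, A (e k) = B (e k)) : A = B := by
  refine ContinuousLinearMap.ext_on
    ((Submodule.dense_iff_topologicalClosure_eq_top).2 e.dense_span) ?_
  rintro _ ⟨k, rfl⟩
  exact h k

lemma repr_apply_of_diagonal (e : HilbertBasis ℕ ℂ H) (f : HilbertBasis ℕ ℂ K) {A : H →L[ℂ] K}
    {c : ℕ → ℂ} (hA : ∀ k, A (e k) = c k • f k) (x : H) (l : ℕ) :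
    f.repr (A x) l = c l * e.repr x l := by
  have h : innerSL ℂ (f l) ∘L A = c l • innerSL ℂ (e l) := by
    refine e.continuousLinearMap_ext fun k => ?_
    rcases eq_or_ne l k with rfl | hk
    · simp [hA, e.orthonormal.1 l, f.orthonormal.1 l, inner_self_eq_norm_sq_to_K]
    · simp [hA, e.orthonormal.inner_eq_zero hk, f.orthonormal.inner_eq_zero hk]
  simpa [HilbertBasis.repr_apply_apply] using DFunLike.congr_fun h x

lemma exists_diagonal (e : HilbertBasis ℕ ℂ H) (f : HilbertBasis ℕ ℂ K) {c : ℕ → ℂ} {C : ℝ}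
    (hc : ∀ l, ‖c l‖ ≤ C) : ∃ A : H →L[ℂ] K, ∀ k, A (e k) = c k • f k := by
  have hC : 0 ≤ C := (norm_nonneg _).trans (hc 0)
  have hp : 0 < (2 : ENNReal).toReal := by norm_num
  have hle : ∀ (x : lp (fun _ : ℕ => ℂ) 2) l,
      ‖c l * x l‖ ^ (2 : ENNReal).toReal ≤ C ^ 2 * ‖x l‖ ^ (2 : ENNReal).toReal := by
    intro x l
    simp only [ENNReal.toReal_ofNat, Real.rpow_ofNat, norm_mul, mul_pow]
    gcongr
    exact hc l
  have hmem : ∀ x : lp (fun _ : ℕ => ℂ) 2, Memℓp (fun l => c l * x l) 2 := fun x =>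
    memℓp_gen (Summable.of_nonneg_of_le (fun l => by positivity) (hle x)
      ((lp.hasSum_norm hp x).summable.mul_left _))
  let L : lp (fun _ : ℕ => ℂ) 2 →ₗ[ℂ] lp (fun _ : ℕ => ℂ) 2 :=
    { toFun := fun x => ⟨fun l => c l * x l, hmem x⟩
      map_add' := fun x y => by ext l; exact mul_add (c l) (x l) (y l)
      map_smul' := fun a x => by ext l; exact mul_left_comm (c l) a (x l) }
  have hL : ∀ x, ‖L x‖ ≤ C * ‖x‖ := by
    intro x
    refine lp.norm_le_of_tsum_le hp (by positivity) ?_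
    rw [Real.mul_rpow hC (norm_nonneg _), lp.norm_rpow_eq_tsum hp, ← tsum_mul_left,
      ENNReal.toReal_ofNat, Real.rpow_ofNat]
    exact ((lp.hasSum_norm hp (L x)).summable).tsum_le_tsum (hle x)
      ((lp.hasSum_norm hp x).summable.mul_left _)
  refine ⟨(f.repr.symm.toContinuousLinearEquiv : lp (fun _ : ℕ => ℂ) 2 →L[ℂ] K) ∘L
    L.mkContinuous C hL ∘L (e.repr.toContinuousLinearEquiv : H →L[ℂ] _), fun k => ?_⟩
  change f.repr.symm (L (e.repr (e k))) = _
  rw [LinearIsometryEquiv.symm_apply_eq, map_smul, e.repr_self, f.repr_self]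
  ext l
  change c l * _ = c k * _
  rcases eq_or_ne l k with rfl | hk
  · rfl
  · rw [lp.single_apply_ne _ _ _ hk, mul_zero, mul_zero]

lemma exists_diagonal_equiv (e : HilbertBasis ℕ ℂ H) (f : HilbertBasis ℕ ℂ K) {c : ℕ → ℂ}
    (hc0 : ∀ l, c l ≠ 0) {C C' : ℝ} (hc : ∀ l, ‖c l‖ ≤ C) (hc' : ∀ l, ‖(c l)⁻¹‖ ≤ C') :
    ∃ A : H ≃L[ℂ] K, ∀ k, A (e k) = c k • f k := by
  obtain ⟨A, hA⟩ := exists_diagonal e f hc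
  obtain ⟨B, hB⟩ := exists_diagonal f e hc'
  have h1 : B ∘L A = ContinuousLinearMap.id ℂ H :=
    e.continuousLinearMap_ext fun k => by simp [hA, hB, smul_smul, hc0 k]
  have h2 : A ∘L B = ContinuousLinearMap.id ℂ K :=
    f.continuousLinearMap_ext fun k => by simp [hA, hB, smul_smul, hc0 k]
  exact ⟨ContinuousLinearEquiv.equivOfInverse A B (DFunLike.congr_fun h1) (DFunLike.congr_fun h2), hA⟩

end HilbertBasis

/-! ### Operator matrices for topological decompositions. -/

namespace TopDecomposition

variable {n : ℕ} {H K : Type*} [NormedAddCommGroup H] [InnerProductSpace ℂ H]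
  [NormedAddCommGroup K] [InnerProductSpace ℂ K]

lemma sum_proj (D : TopDecomposition n H) (x : H) : ∑ i, (D.proj i x : H) = x := by
  have := D.sumEquiv_apply (D.sumEquiv.symm x)
  rw [ContinuousLinearEquiv.apply_symm_apply] at this
  exact this.symm

lemma proj_coe_of_ne (D : TopDecomposition n H) {i j : Fin n} (hij : i ≠ j) (x : D.space j) :
    D.proj i (x : H) = 0 := by
  have h : D.sumEquiv (Pi.single j x) = (x : H) := by
    rw [D.sumEquiv_apply, Finset.sum_eq_single j]
    · simp
    · intro k _ hk
      simp [Pi.single_eq_of_ne hk]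
    · simp
  simp [proj, ← h, Pi.single_eq_of_ne hij]

lemma proj_apply (D : TopDecomposition n H) (T : H →L[ℂ] H) (i : Fin n) (x : H) :
    D.proj i (T x) = ∑ j, D.block T i j (D.proj j x) := by
  conv_lhs => rw [← D.sum_proj x, map_sum, map_sum]
  rfl

/-- Operators with the same matrix up to isomorphisms of the summands are similar. -/
lemma areSimilar_of_block (D : TopDecomposition n H) (E : TopDecomposition n K) {T : H →L[ℂ] H}
    {S : K →L[ℂ] K} (A : ∀ i, D.space i ≃L[ℂ] E.space i)
    (h : ∀ i j x, A i (D.block T i j x) = E.block S i j (A j x)) : AreSimilar T S := by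
  let X : H ≃L[ℂ] K :=
    (D.sumEquiv.symm.trans (ContinuousLinearEquiv.piCongrRight A)).trans E.sumEquiv
  have hX : ∀ i x, E.proj i (X x) = A i (D.proj i x) := by
    intro i x
    change E.sumEquiv.symm (E.sumEquiv _) i = _
    rw [ContinuousLinearEquiv.symm_apply_apply]
    rfl
  refine ⟨X, ContinuousLinearMap.ext fun x => ?_⟩
  change X (T x) = S (X x)
  rw [← E.sum_proj (X (T x)), ← E.sum_proj (S (X x))]
  refine Finset.sum_congr rfl fun i _ => ?_
  rw [hX, D.proj_apply, E.proj_apply, map_sum]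
  simp only [h, hX]

end TopDecomposition

/-! ### Weight products and the coordinates they define. -/

/-- The products `∏ m < k, w i m`, with value `1` for `i` out of range. -/
def weightProd {n : ℕ} (w : Fin n → ℕ → ℂ) (i k : ℕ) : ℂ :=
  if h : i < n then ∏ m ∈ Finset.range k, w ⟨i, h⟩ m else 1

lemma weightProd_of_lt {n : ℕ} (w : Fin n → ℕ → ℂ) {i : ℕ} (h : i < n) (k : ℕ) :
    weightProd w i k = ∏ m ∈ Finset.range k, w ⟨i, h⟩ m := dif_pos h

lemma weightProd_coe {n : ℕ} (w : Fin n → ℕ → ℂ) (i : Fin n) (k : ℕ) :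
    weightProd w i k = ∏ m ∈ Finset.range k, w i m := dif_pos i.2

lemma weightProd_ne_zero {n : ℕ} {w : Fin n → ℕ → ℂ} (hw : ∀ i k, w i k ≠ 0) (i k : ℕ) :
    weightProd w i k ≠ 0 := by
  unfold weightProd
  split_ifs with h
  · exact Finset.prod_ne_zero_iff.2 fun m _ => hw _ m
  · exact one_ne_zero

lemma weightProd_succ {n : ℕ} (w : Fin n → ℕ → ℂ) (i : Fin n) (k : ℕ) :
    weightProd w i (k + 1) = weightProd w i k * w i k := by
  rw [weightProd_coe, weightProd_coe, Finset.prod_range_succ]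

section

variable {n : ℕ} {H : Type*} [NormedAddCommGroup H] [InnerProductSpace ℂ H] [CompleteSpace H]
  {D : TopDecomposition n H} {T : H →L[ℂ] H}

lemma IsInOF.proj_apply {𝒜 : OperatorClass} (hT : IsInOF 𝒜 D T) (i : Fin n) (x : H) :
    D.proj i (T x) = D.block T i i (D.proj i x) +
      if h : (i : ℕ) + 1 < n then D.block T i ⟨i + 1, h⟩ (D.proj ⟨i + 1, h⟩ x) else 0 := by
  rw [D.proj_apply, ← Finset.add_sum_erase _ _ (Finset.mem_univ i)]
  congr 1
  have hz : ∀ j : Fin n, j ≠ i → (j : ℕ) ≠ i + 1 → D.block T i j (D.proj j x) = 0 := by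
    intro j h1 h2
    have h1' : (j : ℕ) ≠ i := fun h => h1 (Fin.ext h)
    rcases lt_or_gt_of_ne h1' with h | h
    · rw [hT.upper i j h]; rfl
    · rw [hT.eq_zero_above i j (by omega)]; rfl
  split_ifs with h
  · refine Finset.sum_eq_single_of_mem _ (Finset.mem_erase.2 ⟨?_, Finset.mem_univ _⟩) ?_
    · simp [Fin.ext_iff]
    · intro j hj hj'
      exact hz j (Finset.ne_of_mem_erase hj) fun h' => hj' (Fin.ext h')
  · refine Finset.sum_eq_zero fun j hj => hz j (Finset.ne_of_mem_erase hj) ?_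
    have := j.2
    omega

/-- The coordinates of an operator in `OF_n` given by weighted shifts and the links between them. -/
noncomputable def shiftCoordinates {𝒜 : OperatorClass} (hT : IsInOF 𝒜 D T)
    (e : ∀ i, HilbertBasis ℕ ℂ (D.space i)) {w : Fin n → ℕ → ℂ} (hw : ∀ i k, w i k ≠ 0)
    (hdiag : ∀ i, IsBackwardWeightedShift (e i) (w i) (D.block T i i))
    (hlink : ∀ i j : Fin n, (j : ℕ) = i + 1 → ∀ k : ℕ,
      D.block T i j (e j k) =
        ((∏ m ∈ Finset.range k, w j m) / ∏ m ∈ Finset.range k, w i m) • e i k) :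
    ShiftCoordinates n T (weightProd w) where
  -- Vectors are divided and functionals multiplied by the weight product, which turns the weights
  -- and the link coefficients into `1`.
  vec j k := if h : j < n then (weightProd w j k)⁻¹ • (e ⟨j, h⟩ k : H) else 0
  coord i l := if h : i < n then
    weightProd w i l • (innerSL ℂ (e ⟨i, h⟩ l) ∘L D.proj ⟨i, h⟩) else 0
  coord_vec := by
    intro i j l k hi hj
    simp only [dif_pos hi, dif_pos hj, smul_apply, map_smul,
      ContinuousLinearMap.comp_apply]
    rcases eq_or_ne i j with rfl | hij
    · rw [D.proj_coe]
      rcases eq_or_ne l k with rfl | hlk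
      · simp [(e ⟨i, hi⟩).orthonormal.1 l, weightProd_ne_zero hw]
      · simp [(e ⟨i, hi⟩).orthonormal.inner_eq_zero hlk, hlk]
    · rw [D.proj_coe_of_ne (by simpa [Fin.ext_iff] using hij)]
      simp [hij]
  coord_eq_zero i l hi := dif_neg (by omega)
  eq_zero_of_coord := by
    intro x hx
    rw [← D.sum_proj x]
    refine Finset.sum_eq_zero fun i _ => ?_
    rw [ZeroMemClass.coe_eq_zero]
    refine (e i).repr.map_eq_zero_iff.1 ?_
    ext l
    have := hx i l
    simp only [dif_pos i.2, smul_apply, ContinuousLinearMap.comp_apply,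
      smul_eq_zero, weightProd_ne_zero hw, false_or] at this
    rw [HilbertBasis.repr_apply_apply]
    exact this
  coord_apply := by
    intro i l x
    rcases lt_or_ge i n with hi | hi
    swap
    · simp [show ¬ i < n by omega, show ¬ i + 1 < n by omega]
    have hs := (hdiag ⟨i, hi⟩).repr_apply (D.proj ⟨i, hi⟩ x) l
    have hβ := weightProd_succ w ⟨i, hi⟩ l
    simp only at hβ
    simp only [dif_pos hi, smul_apply, ContinuousLinearMap.comp_apply,
      hT.proj_apply, map_add, innerSL_apply_apply, ← HilbertBasis.repr_apply_apply, smul_eq_mul,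
      mul_add]
    congr 1
    · rw [hs, hβ, mul_assoc]
    · split_ifs with h
      · have hr := (e ⟨i + 1, h⟩).repr_apply_of_diagonal (e ⟨i, hi⟩)
          (hlink ⟨i, hi⟩ ⟨i + 1, h⟩ rfl) (D.proj ⟨i + 1, h⟩ x) l
        simp only [smul_apply, ContinuousLinearMap.comp_apply,
          innerSL_apply_apply, ← HilbertBasis.repr_apply_apply, smul_eq_mul, hr,
          ← weightProd_of_lt]
        field_simp [weightProd_ne_zero hw i l]
      · simp
  -- The summands need not be orthogonal, so norms of oblique projections enter; their sum serves
  -- all `i` at once.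
  bound := ∑ i, ‖D.proj i‖
  norm_coord_le := by
    intro i l hi
    rw [dif_pos hi, norm_smul, mul_comm]
    gcongr
    refine (ContinuousLinearMap.opNorm_comp_le _ _).trans ?_
    rw [innerSL_apply_norm, (e ⟨i, hi⟩).orthonormal.1, one_mul]
    exact Finset.single_le_sum (f := fun i => ‖D.proj i‖) (fun i _ => norm_nonneg (D.proj i))
      (Finset.mem_univ _)
  norm_vec_le := by
    intro j k hj
    have h1 : ‖(e ⟨j, hj⟩ k : H)‖ = 1 := (e ⟨j, hj⟩).orthonormal.1 k
    rw [dif_pos hj, norm_smul, h1, norm_inv, mul_one,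
      inv_mul_cancel₀ (norm_ne_zero_iff.2 (weightProd_ne_zero hw j k))]

end

/-! ### Quasi-similarity against similarity. -/

theorem mainTheorem4 {n : ℕ} (hn : 2 ≤ n)
    {H H' : Type*} [NormedAddCommGroup H] [InnerProductSpace ℂ H] [CompleteSpace H]
    [NormedAddCommGroup H'] [InnerProductSpace ℂ H'] [CompleteSpace H']
    (D : TopDecomposition n H) (D' : TopDecomposition n H')
    (T : H →L[ℂ] H) (T' : H' →L[ℂ] H')
    (hT : IsInOF onbShifts D T) (hT' : IsInOF onbShifts D' T')
    (e : ∀ i, HilbertBasis ℕ ℂ (D.space i)) (e' : ∀ i, HilbertBasis ℕ ℂ (D'.space i))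
    (w w' : Fin n → ℕ → ℂ)
    (hw : ∀ i k, w i k ≠ 0) (hw' : ∀ i k, w' i k ≠ 0)
    (hdiag : ∀ i, IsBackwardWeightedShift (e i) (w i) (D.block T i i))
    (hdiag' : ∀ i, IsBackwardWeightedShift (e' i) (w' i) (D'.block T' i i))
    (hlink : ∀ i j : Fin n, (j : ℕ) = i + 1 → ∀ k : ℕ,
      D.block T i j (e j k) =
        ((∏ m ∈ Finset.range k, w j m) / ∏ m ∈ Finset.range k, w i m) • e i k)
    (hlink' : ∀ i j : Fin n, (j : ℕ) = i + 1 → ∀ k : ℕ,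
      D'.block T' i j (e' j k) =
        ((∏ m ∈ Finset.range k, w' j m) / ∏ m ∈ Finset.range k, w' i m) • e' i k) :
    AreQuasiSimilar T T' ↔ AreSimilar T T' := by
  constructor
  · rintro ⟨X, Y, ⟨hX, -⟩, ⟨hY, -⟩, hXT, hYT⟩
    have hXT' : ∀ x, X (T x) = T' (X x) := fun x => DFunLike.congr_fun hXT x
    have hYT' : ∀ y, Y (T' y) = T (Y y) := fun y => (DFunLike.congr_fun hYT y).symm
    let C := shiftCoordinates hT e hw hdiag hlink
    let C' := shiftCoordinates hT' e' hw' hdiag' hlink'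
    have h1 := C.exists_norm_le C' hX hXT' hY hYT' (weightProd_ne_zero hw)
      (M := fun i => if h : i < n then ‖D.block T ⟨i, h⟩ ⟨i, h⟩‖ else 0)
      (fun i hi l => by
        rw [weightProd_succ w ⟨i, hi⟩ l, norm_mul, mul_comm, dif_pos hi]
        gcongr
        exact (hdiag ⟨i, hi⟩).norm_weight_le l)
      (fun i hi d hd => (hT.diag_mem ⟨i, hi⟩).1
        ((hdiag ⟨i, hi⟩).isQuasiNilpotent (hw _) d (by simpa only [weightProd_of_lt w hi] using hd)))
    have h2 := C'.exists_norm_le C hY hYT' hX hXT' (weightProd_ne_zero hw')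
      (M := fun i => if h : i < n then ‖D'.block T' ⟨i, h⟩ ⟨i, h⟩‖ else 0)
      (fun i hi l => by
        rw [weightProd_succ w' ⟨i, hi⟩ l, norm_mul, mul_comm, dif_pos hi]
        gcongr
        exact (hdiag' ⟨i, hi⟩).norm_weight_le l)
      (fun i hi d hd => (hT'.diag_mem ⟨i, hi⟩).1
        ((hdiag' ⟨i, hi⟩).isQuasiNilpotent (hw' _) d
          (by simpa only [weightProd_of_lt w' hi] using hd)))
    have hβ := weightProd_ne_zero hw
    have hβ' := weightProd_ne_zero hw'
    -- The ratio of weight products carries one diagonal shift to the other; its common value `1` at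
    -- `k = 0` makes the `A i` compatible with the links too. The two comparisons `h1` and `h2`
    -- bound the ratio and its inverse.
    have hA : ∀ i : Fin n, ∃ A : D.space i ≃L[ℂ] D'.space i,
        ∀ k, A (e i k) = (weightProd w i k / weightProd w' i k) • e' i k := by
      intro i
      obtain ⟨B, hB⟩ := h1 i i.2
      obtain ⟨B', hB'⟩ := h2 i i.2
      refine (e i).exists_diagonal_equiv (e' i) (C := B) (C' := B')
        (fun l => div_ne_zero (hβ i l) (hβ' i l)) (fun l => ?_) (fun l => ?_)
      · rw [norm_div, div_le_iff₀ (norm_pos_iff.2 (hβ' i l))]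
        exact hB l
      · rw [inv_div, norm_div, div_le_iff₀ (norm_pos_iff.2 (hβ i l))]
        exact hB' l
    choose A hA using hA
    refine D.areSimilar_of_block D' A fun i j => ?_
    suffices h : (A i : D.space i →L[ℂ] D'.space i) ∘L D.block T i j =
        D'.block T' i j ∘L (A j : D.space j →L[ℂ] D'.space j) from DFunLike.congr_fun h
    rcases lt_trichotomy (j : ℕ) i with hij | hij | hij
    · rw [hT.upper i j hij, hT'.upper i j hij, ContinuousLinearMap.comp_zero,
        ContinuousLinearMap.zero_comp]
    · obtain rfl : j = i := Fin.ext hij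
      refine (e j).continuousLinearMap_ext fun k => ?_
      rcases k with _ | k
      · simp [hA, (hdiag j).1, (hdiag' j).1]
      · simp only [ContinuousLinearMap.comp_apply, ContinuousLinearEquiv.coe_coe, hA, map_smul,
          (hdiag j).2, (hdiag' j).2, smul_smul, weightProd_succ]
        congr 1
        field_simp [hβ j k, hβ' j k, hw' j k]
    · rcases eq_or_ne (j : ℕ) (i + 1) with hj | hj
      · refine (e j).continuousLinearMap_ext fun k => ?_
        simp only [ContinuousLinearMap.comp_apply, ContinuousLinearEquiv.coe_coe, hA, map_smul,
          hlink i j hj, hlink' i j hj, smul_smul, ← weightProd_coe]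
        congr 1
        field_simp [hβ i k, hβ' i k, hβ' j k]
      · rw [hT.eq_zero_above i j (by omega), hT'.eq_zero_above i j (by omega),
          ContinuousLinearMap.comp_zero, ContinuousLinearMap.zero_comp]
  · rintro ⟨X, hX⟩
    refine ⟨X, X.symm, ⟨X.injective, X.surjective.denseRange⟩,
      ⟨X.symm.injective, X.symm.surjective.denseRange⟩, hX, ContinuousLinearMap.ext fun y => ?_⟩
    have := DFunLike.congr_fun hX (X.symm y)
    simp only [ContinuousLinearMap.comp_apply, ContinuousLinearEquiv.coe_coe,
      ContinuousLinearEquiv.apply_symm_apply] at this ⊢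
    rw [← this, ContinuousLinearEquiv.symm_apply_apply]
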